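/- Let $\varrho$ be a primitive substitution on a finite alphabet $\{a_1,\dots,a_N\}$ with substitution matrix $M$, where $M_{ij}$ is the number of letters $a_i$ in $\varrho(a_j)$. Assume that the Perron–Frobenius eigenvalue $\lambda$ of $M$ is a Pisot–Vijayaraghavan unit, that is, $\lambda>1$, both $\lambda$ and $\lambda^{-1}$ are algebraic integers, and all algebraic conjugates of $\lambda$ other than $\lambda$ itself lie in the open unit disk. Let $v$ be the strictly positive right eigenvector, $Mv=\lambda v$, normalised by $\sum_i v_i=1$, and let $(\ell_1,\dots,\ell_N)$ be a strictly positive left eigenvector of $M$ for $\lambda$ (the natural tile lengths) with all $\ell_i\in\mathbb{Z}[\lambda]$. Let $T_{ij}\subset\mathbb{Z}[\lambda]$ be the finite set of positions of the left endpoints of the tiles of type $i$ in the supertile $\varrho(a_j)$ placed at $0$, so if $\varrho(a_j)=a_{k_1}\cdots a_{k_n}$, then $T_{ij}=\{\ell_{k_1}+\dots+\ell_{k_{p-1}} : 1\leqslant p\leqslant n,\ k_p=i\}$. Let $d$ be the degree of $\lambda$. Let $\kappa_2,\dots,\kappa_r$ be the real embeddings of $\mathbb{Q}(\lambda)$ other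 than the identity and let $\sigma_1,\dots,\sigma_s$ be representatives of the pairs of complex conjugate non-real embeddings, so $d=r+2s$. Identify the internal space $\mathbb{R}^{d-1}$ with $\mathbb{R}^{r-1}\times\mathbb{C}^s$, let $x^\star=(\kappa_2(x),\dots,\kappa_r(x),\sigma_1(x),\dots,\sigma_s(x))$ for $x\in\mathbb{Q}(\lambda)$, and let $Q$ be the linear map on $\mathbb{R}^{d-1}$ that multiplies each coordinate by the corresponding conjugate $\kappa_i(\lambda)$ or $\sigma_j(\lambda)$. Let $(W_1,\dots,W_N)$ be the unique $N$-tuple of non-empty compact subsets of $\mathbb{R}^{d-1}$ with $$W_i=\bigcup_{j=1}^N\bigcup_{t\in T_{ij}}\bigl(QW_j+t^\star\bigr)\qquad(1\leqslant i\leqslant N).$$ For an $N$-tuple $\mu=(\mu_1,\dots,\mu_N)$ of finite positive Borel measures on $\mathbb{R}^{d-1}$, define the $N$-tuple $\Psi(\mu)$ by $$\Psi(\mu)_i=\frac1\lambda\sum_{j=1}^N\sum_{t\in T_{ij}}\delta_{t^\star}*(Q.\mu_j),$$ where $Q.\mu$ denotes the push-forward of $\mu$ under $Q$. **Proposition.**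 Let $\alpha>0$ and let $\mathcal{M}_\alpha$ be the set of all $N$-tuples $(\nu_1,\dots,\nu_N)$ of finite positive Borel measures on $\mathbb{R}^{d-1}$ with $\nu_i(\mathbb{R}^{d-1})=\alpha v_i$ for all $i$. Then $\Psi(\mathcal{M}_\alpha)\subseteq\mathcal{M}_\alpha$, and $\mathcal{M}_\alpha$ contains precisely one solution of $\nu=\Psi(\nu)$, namely $$\nu_i=\frac{\alpha\,v_i}{\operatorname{vol}(W_i)}\,1_{W_i}\,\mu_{\mathrm{Leb}}\qquad(1\leqslant i\leqslant N),$$ where $\mu_{\mathrm{Leb}}$ is Lebesgue measure on $\mathbb{R}^{d-1}$ and $\operatorname{vol}$ denotes volume with respect to it. -/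

import Mathlib

open MeasureTheory IntermediateField
open scoped Matrix

noncomputable section

namespace PVInflation

/-- The substitution matrix: the `(i, j)` entry counts the letters `i` in the word `ρ j`. -/
def substMatrix {A : Type*} [DecidableEq A] (ρ : A → List A) : Matrix A A ℝ :=
  Matrix.of fun i j => ((ρ j).count i : ℝ)

/-- `lam` is the Perron-Frobenius eigenvalue of `M`: it is an eigenvalue, and it dominates the
modulus of every complex eigenvalue. -/
def IsPFEigenvalue {A : Type*} [Fintype A] [DecidableEq A] (M : Matrix A A ℝ) (lam : ℝ) : Prop :=
  (lam : ℂ) ∈ spectrum ℂ (M.map ((↑) : ℝ → ℂ)) ∧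
    ∀ z ∈ spectrum ℂ (M.map ((↑) : ℝ → ℂ)), ‖z‖ ≤ lam

/-- Pisot-Vijayaraghavan units: real algebraic integers `lam > 1` whose inverse is an algebraic
integer too and whose algebraic conjugates other than `lam` lie in the open unit disk. -/
def IsPVUnit (lam : ℝ) : Prop :=
  1 < lam ∧ IsIntegral ℤ lam ∧ IsIntegral ℤ lam⁻¹ ∧
    ∀ z ∈ (minpoly ℚ lam).rootSet ℂ, z ≠ (lam : ℂ) → ‖z‖ < 1

/-- The geometric displacement set: the relative positions (of the left endpoints) of the tiles of
type `i` in the supertile of type `j`, where a tile of type `a` has length `len a`. -/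
def displacement {A R : Type*} [DecidableEq A] [AddMonoid R] [DecidableEq R]
    (ρ : A → List A) (len : A → R) (i j : A) : Finset R :=
  ((Finset.range (ρ j).length).filter fun k => (ρ j)[k]? = some i).image
    fun k => (((ρ j).take k).map len).sum

/-- A listing of the embeddings of `ℚ(lam)` that are used for the Minkowski embedding: `κ` lists
the real embeddings other than the inclusion, without repetition, and `σ` picks exactly one
member from each pair of complex conjugate non-real embeddings. -/
structure Conjugates (lam : ℝ) (m s : ℕ) where
  /-- the real embeddings other than the inclusion -/
  κ : Fin m → ℚ⟮lam⟯ →+* ℝ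
  /-- representatives of the pairs of non-real embeddings -/
  σ : Fin s → ℚ⟮lam⟯ →+* ℂ
  κ_injective : Function.Injective κ
  κ_range : ∀ τ : ℚ⟮lam⟯ →+* ℝ, (∃ i, κ i = τ) ↔ τ ≠ algebraMap ℚ⟮lam⟯ ℝ
  σ_nonreal : ∀ j, ¬ NumberField.ComplexEmbedding.IsReal (σ j)
  σ_pairs : ∀ τ : ℚ⟮lam⟯ →+* ℂ, ¬ NumberField.ComplexEmbedding.IsReal τ →
    ∃! j, τ = σ j ∨ τ = NumberField.ComplexEmbedding.conjugate (σ j)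

/-- Internal space `ℝ ^ m × ℂ ^ s`, that is `ℝ ^ (d - 1)` with `d = 1 + m + 2 * s`, each complex
coordinate standing for its real and imaginary part; `volume` on it is Lebesgue measure. -/
abbrev Internal (m s : ℕ) : Type := (Fin m → ℝ) × (Fin s → ℂ)

variable {lam : ℝ} {m s : ℕ}

/-- The star map `ℚ(lam) → ℝ ^ (d - 1)`. -/
def starMap (E : Conjugates lam m s) (x : ℚ⟮lam⟯) : Internal m s :=
  (fun i => E.κ i x, fun j => E.σ j x)

/-- The linear map on internal space induced by the dilation `x ↦ lam * x`: coordinatewise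
multiplication by the conjugates of `lam`. -/
def Q (E : Conjugates lam m s) (y : Internal m s) : Internal m s :=
  (fun i => E.κ i (AdjoinSimple.gen ℚ lam) * y.1 i,
    fun j => E.σ j (AdjoinSimple.gen ℚ lam) * y.2 j)

/-- The tuple `W` of non-empty compact sets solves the window equations
`W i = ⋃ j, ⋃ t ∈ T i j, Q (W j) + t⋆`. -/
def IsWindow {A : Type*} (E : Conjugates lam m s) (T : A → A → Finset ℚ⟮lam⟯)
    (W : A → TopologicalSpace.NonemptyCompacts (Internal m s)) : Prop :=
  ∀ i, (W i : Set (Internal m s)) =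
    ⋃ j, ⋃ t ∈ T i j, (fun y => Q E y + starMap E t) '' (W j : Set (Internal m s))

/-- The measure iteration
`μ i ↦ lam⁻¹ * ∑ j, ∑ t ∈ T i j, δ_{t⋆} ∗ (Q.μ j)`, with `Q.μ` the push-forward. -/
def measureStep {A : Type*} [Fintype A] (E : Conjugates lam m s)
    (T : A → A → Finset ℚ⟮lam⟯) (μ : A → Measure (Internal m s)) :
    A → Measure (Internal m s) :=
  fun i => ENNReal.ofReal lam⁻¹ •
    ∑ j, ∑ t ∈ T i j, (Measure.dirac (starMap E t)).conv ((μ j).map (Q E))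

/-- Tuples of finite positive measures with total masses `α * v i`. -/
def massSpace {A : Type*} (m s : ℕ) (α : ℝ) (v : A → ℝ) : Set (A → Measure (Internal m s)) :=
  {ν | ∀ i, IsFiniteMeasure (ν i) ∧ ν i Set.univ = ENNReal.ofReal (α * v i)}

/-- The measures `(α * v i / vol (W i)) 1_{W i} μ_Leb`. -/
def windowMeasure {A : Type*} (α : ℝ) (v : A → ℝ)
    (W : A → TopologicalSpace.NonemptyCompacts (Internal m s)) : A → Measure (Internal m s) :=
  fun i => (ENNReal.ofReal (α * v i) / volume (W i : Set (Internal m s))) •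
    volume.restrict (W i : Set (Internal m s))

end PVInflation

end

noncomputable section

namespace PVInflation

variable {lam : ℝ} {m s : ℕ}

/-! Uniqueness is a Fourier argument (`eq_of_eq_measureStep`). On characteristic functions the
iteration multiplies by phases and replaces the argument L by L ∘ Q. The difference of two fixed
points is therefore dominated by λ⁻¹M applied to the difference at L ∘ Q, and since Mv = λv, a bound
c·v passes back from L ∘ Qⁿ to L without loss. As Qⁿ → 0, the values at L ∘ Qⁿ tend to the common
total masses, so c can be taken arbitrarily small.

For existence, λ being a unit gives |det Q| = λ⁻¹, so Lebesgue measure on the windows is dominated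
by its image under the iteration, which counts overlaps repeatedly. Pairing the volumes with the
positive left eigenvector shows that the total masses agree. Hence the measures agree, and the
volume vector is an eigenvector, a multiple of v by primitivity
(`IsWindow.volume_eq_and_invariant`).

The volumes must not all vanish (`IsWindow.volume_iUnion_pos`). A nonzero algebraic integer has norm
at least 1 in modulus, so tile endpoints at distance O(N) have star images at distance at least of
order N^(-1/D), where D = d - 1. N such points in the union of the windows carry disjoint balls
whose total volume is bounded below independently of N. -/

/-! ### Embeddings of ℚ(λ) and norms. -/

/-- All complex embeddings of `ℚ(lam)`, in terms of a listing of the conjugates. -/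
def Conjugates.embedding (E : Conjugates lam m s) :
    (Unit ⊕ Fin m) ⊕ (Fin s ⊕ Fin s) → (ℚ⟮lam⟯ →+* ℂ)
  | .inl (.inl _) => Complex.ofRealHom.comp (algebraMap ℚ⟮lam⟯ ℝ)
  | .inl (.inr i) => Complex.ofRealHom.comp (E.κ i)
  | .inr (.inl j) => E.σ j
  | .inr (.inr j) => NumberField.ComplexEmbedding.conjugate (E.σ j)

theorem isReal_ofRealHom_comp {K : Type*} [Field K] (τ : K →+* ℝ) :
    NumberField.ComplexEmbedding.IsReal (Complex.ofRealHom.comp τ) := by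
  rw [NumberField.ComplexEmbedding.isReal_iff]
  ext x
  simp

theorem ofRealHom_comp_injective {K : Type*} [Field K] :
    Function.Injective fun τ : K →+* ℝ => Complex.ofRealHom.comp τ := by
  intro τ τ' h
  ext x
  have := RingHom.congr_fun h x
  simpa using this

theorem Conjugates.κ_ne (E : Conjugates lam m s) (i : Fin m) :
    E.κ i ≠ algebraMap ℚ⟮lam⟯ ℝ :=
  (E.κ_range _).1 ⟨i, rfl⟩

theorem Conjugates.embedding_bijective (E : Conjugates lam m s) :
    Function.Bijective E.embedding := by
  have hr := fun τ : ℚ⟮lam⟯ →+* ℝ => isReal_ofRealHom_comp τ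
  have hc : ∀ j, ¬ NumberField.ComplexEmbedding.IsReal
      (NumberField.ComplexEmbedding.conjugate (E.σ j)) := fun j => by
    rw [NumberField.ComplexEmbedding.isReal_conjugate_iff]
    exact E.σ_nonreal j
  have hσ : ∀ j k, (E.σ j = E.σ k ∨
      E.σ j = NumberField.ComplexEmbedding.conjugate (E.σ k)) → j = k := fun j k h =>
    (E.σ_pairs (E.σ j) (E.σ_nonreal j)).unique (Or.inl rfl) h
  have hσ' : ∀ j k, E.σ j ≠ NumberField.ComplexEmbedding.conjugate (E.σ k) := by
    intro j k h
    obtain rfl := hσ j k (Or.inr h)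
    exact E.σ_nonreal j (NumberField.ComplexEmbedding.isReal_iff.2 h.symm)
  constructor
  · rintro ((⟨⟩ | i) | (j | j)) ((⟨⟩ | i') | (j' | j')) h <;> simp only [Conjugates.embedding] at h
    · rfl
    · exact absurd (ofRealHom_comp_injective h).symm (E.κ_ne i')
    · exact absurd (h ▸ hr _) (E.σ_nonreal j')
    · exact absurd (h ▸ hr _) (hc j')
    · exact absurd (ofRealHom_comp_injective h) (E.κ_ne i)
    · rw [E.κ_injective (ofRealHom_comp_injective h)]
    · exact absurd (h ▸ hr _) (E.σ_nonreal j')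
    · exact absurd (h ▸ hr _) (hc j')
    · exact absurd (h ▸ hr _) (E.σ_nonreal j)
    · exact absurd (h ▸ hr _) (E.σ_nonreal j)
    · rw [hσ _ _ (Or.inl h)]
    · exact absurd h (hσ' _ _)
    · exact absurd (h ▸ hr _) (hc j)
    · exact absurd (h ▸ hr _) (hc j)
    · exact absurd h.symm (hσ' _ _)
    · have : E.σ j = E.σ j' := by
        have := congrArg NumberField.ComplexEmbedding.conjugate h
        simpa using this
      rw [hσ _ _ (Or.inl this)]
  · intro τ
    by_cases hτ : NumberField.ComplexEmbedding.IsReal τ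
    · have h : Complex.ofRealHom.comp hτ.embedding = τ := by
        ext x
        simp
      by_cases he : hτ.embedding = algebraMap ℚ⟮lam⟯ ℝ
      · exact ⟨.inl (.inl ()), by simp only [Conjugates.embedding]; rw [← he, h]⟩
      · obtain ⟨i, hi⟩ := (E.κ_range _).2 he
        exact ⟨.inl (.inr i), by simp only [Conjugates.embedding]; rw [hi, h]⟩
    · obtain ⟨j, hj | hj, -⟩ := E.σ_pairs τ hτ
      · exact ⟨.inr (.inl j), hj.symm⟩
      · exact ⟨.inr (.inr j), hj.symm⟩

theorem Conjugates.abs_norm (E : Conjugates lam m s) (hlam : IsIntegral ℚ lam) (x : ℚ⟮lam⟯) :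
    |((Algebra.norm ℚ x : ℚ) : ℝ)| =
      |(x : ℝ)| * ((∏ i, |E.κ i x|) * (∏ j, ‖E.σ j x‖ ^ 2)) := by
  have : FiniteDimensional ℚ ℚ⟮lam⟯ := adjoin.finiteDimensional hlam
  have h := Algebra.norm_eq_prod_embeddings ℚ ℂ x
  have h2 : ∏ τ : ℚ⟮lam⟯ →ₐ[ℚ] ℂ, ‖τ x‖ =
      ∏ a, ‖E.embedding a x‖ := by
    symm
    refine Fintype.prod_bijective
      (fun a => RingHom.equivRatAlgHom _ _ (E.embedding a))
      ((RingHom.equivRatAlgHom _ _).bijective.comp E.embedding_bijective) _ _ fun a => ?_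
    simp [RingHom.equivRatAlgHom_apply]
  have h3 := congrArg norm h
  rw [norm_prod, h2, Fintype.prod_sum_type, Fintype.prod_sum_type, Fintype.prod_sum_type] at h3
  simp only [Conjugates.embedding, Finset.univ_unique, Finset.prod_singleton, RingHom.comp_apply,
    Complex.ofRealHom_eq_coe, Complex.norm_real, NumberField.ComplexEmbedding.conjugate_coe_eq,
    RCLike.norm_conj, ← pow_two, Real.norm_eq_abs,
    eq_ratCast, Complex.norm_ratCast, mul_assoc] at h3
  simpa [Finset.prod_pow] using h3

theorem one_le_abs_norm (hlam : IsIntegral ℚ lam) {x : ℚ⟮lam⟯} (hx : IsIntegral ℤ x)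
    (h0 : x ≠ 0) : 1 ≤ |((Algebra.norm ℚ x : ℚ) : ℝ)| := by
  have : FiniteDimensional ℚ ℚ⟮lam⟯ := adjoin.finiteDimensional hlam
  obtain ⟨n, hn⟩ := IsIntegrallyClosed.isIntegral_iff.1 (Algebra.isIntegral_norm ℚ hx)
  have hn0 : n ≠ 0 := by
    rintro rfl
    rw [map_zero] at hn
    exact h0 (Algebra.norm_eq_zero_iff.1 hn.symm)
  rw [← hn]
  simpa using (by exact_mod_cast Int.one_le_abs hn0 : (1 : ℝ) ≤ |(n : ℝ)|)

theorem isIntegral_of_coe {x : ℚ⟮lam⟯} (hx : IsIntegral ℤ (x : ℝ)) : IsIntegral ℤ x :=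
  (isIntegral_algebraMap_iff (A := ℚ⟮lam⟯) (B := ℝ) (algebraMap ℚ⟮lam⟯ ℝ).injective).1 hx

/-- Distinct algebraic integers of `ℚ(lam)` that are close in internal space are far apart in
physical space. -/
theorem Conjugates.one_le_mul_norm_starMap_pow (E : Conjugates lam m s) (hlam : IsIntegral ℚ lam)
    {x : ℚ⟮lam⟯} (hx : IsIntegral ℤ x) (h0 : x ≠ 0) :
    1 ≤ |(x : ℝ)| * ‖starMap E x‖ ^ (m + 2 * s) := by
  refine (one_le_abs_norm hlam hx h0).trans ?_
  rw [E.abs_norm hlam]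
  gcongr
  rw [pow_add, pow_mul']
  have h1 : ∀ i, |E.κ i x| ≤ ‖starMap E x‖ := fun i =>
    (norm_le_pi_norm (fun i => E.κ i x) i).trans (norm_fst_le (starMap E x))
  have h2 : ∀ j, ‖E.σ j x‖ ≤ ‖starMap E x‖ := fun j =>
    (norm_le_pi_norm (fun j => E.σ j x) j).trans (norm_snd_le (starMap E x))
  gcongr
  · calc _ ≤ ∏ _i : Fin m, ‖starMap E x‖ := Finset.prod_le_prod (fun _ _ => abs_nonneg _) fun i _ => h1 i
      _ = _ := by simp
  · calc _ ≤ ∏ _i : Fin s, ‖starMap E x‖ ^ 2 :=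
        Finset.prod_le_prod (fun _ _ => by positivity) fun i _ => by gcongr; exact h2 i
      _ = _ := by simp [← pow_mul, mul_comm]

theorem IsPVUnit.isIntegral_rat (h : IsPVUnit lam) : IsIntegral ℚ lam := h.2.1.tower_top

/-- Both λ and λ⁻¹ are algebraic integers, so the norm of λ has modulus 1; the factor missing from
the product is λ itself. -/
theorem IsPVUnit.prod_conjugates (h : IsPVUnit lam) (E : Conjugates lam m s) :
    (∏ i, |E.κ i (AdjoinSimple.gen ℚ lam)|) * (∏ j, ‖E.σ j (AdjoinSimple.gen ℚ lam)‖ ^ 2)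
      = lam⁻¹ := by
  have hpos : 0 < lam := zero_lt_one.trans h.1
  have hlam := h.isIntegral_rat
  set g := AdjoinSimple.gen ℚ lam with hg
  have hgc : (g : ℝ) = lam := AdjoinSimple.coe_gen ℚ lam
  have hg0 : g ≠ 0 := by
    intro h0
    rw [h0] at hgc
    simp at hgc
    exact hpos.ne hgc
  have h1 := one_le_abs_norm hlam (isIntegral_of_coe (x := g) (by rw [hgc]; exact h.2.1)) hg0
  have h2 := one_le_abs_norm hlam (isIntegral_of_coe (x := g⁻¹)
    (by push_cast; rw [hgc]; exact h.2.2.1)) (inv_ne_zero hg0)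
  have h3 : |((Algebra.norm ℚ g : ℚ) : ℝ)| = 1 := by
    refine le_antisymm ?_ h1
    have h4 : Algebra.norm ℚ g * Algebra.norm ℚ g⁻¹ = 1 := by
      rw [← map_mul, mul_inv_cancel₀ hg0, map_one]
    rw [eq_inv_of_mul_eq_one_right h4, Rat.cast_inv, abs_inv] at h2
    exact (one_le_inv₀ (zero_lt_one.trans_le h1)).1 h2
  rw [E.abs_norm hlam, hgc, abs_of_pos hpos] at h3
  exact eq_inv_of_mul_eq_one_right h3

theorem IsPVUnit.dim_pos (h : IsPVUnit lam) (E : Conjugates lam m s) : 0 < m + 2 * s := by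
  by_contra h0
  obtain ⟨rfl, rfl⟩ : m = 0 ∧ s = 0 := by omega
  have h1 := h.prod_conjugates E
  simp at h1
  exact h.1.ne' h1

/-- The image of the generator is a root of the minimal polynomial, and it differs from λ because an
embedding is determined by its value at the generator. -/
theorem IsPVUnit.norm_embedding_lt_one (h : IsPVUnit lam) (τ : ℚ⟮lam⟯ →+* ℂ)
    (hτ : τ ≠ Complex.ofRealHom.comp (algebraMap ℚ⟮lam⟯ ℝ)) :
    ‖τ (AdjoinSimple.gen ℚ lam)‖ < 1 := by
  have hlam := h.isIntegral_rat
  let toAlg (τ : ℚ⟮lam⟯ →+* ℂ) : ℚ⟮lam⟯ →ₐ[ℚ] ℂ :=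
    { τ with commutes' := fun r => by simp [eq_ratCast (algebraMap ℚ ℚ⟮lam⟯) r] }
  refine h.2.2.2 _ ?_ ?_
  · rw [Polynomial.mem_rootSet]
    refine ⟨minpoly.ne_zero hlam, ?_⟩
    have h1 := Polynomial.aeval_algHom_apply (toAlg τ) (AdjoinSimple.gen ℚ lam) (minpoly ℚ lam)
    exact h1.trans ((congrArg _ (aeval_gen_minpoly ℚ lam)).trans (map_zero _))
  · intro he
    apply hτ
    have h1 : toAlg τ = toAlg (Complex.ofRealHom.comp (algebraMap ℚ⟮lam⟯ ℝ)) := by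
      refine (adjoin.powerBasis hlam).algHom_ext ?_
      rw [adjoin.powerBasis_gen]
      change τ (AdjoinSimple.gen ℚ lam) = (((AdjoinSimple.gen ℚ lam : ℚ⟮lam⟯) : ℝ) : ℂ)
      rw [he, AdjoinSimple.coe_gen]
    ext x
    exact AlgHom.congr_fun h1 x

theorem IsPVUnit.abs_κ_lt_one (h : IsPVUnit lam) (E : Conjugates lam m s) (i : Fin m) :
    |E.κ i (AdjoinSimple.gen ℚ lam)| < 1 := by
  have := h.norm_embedding_lt_one (Complex.ofRealHom.comp (E.κ i))
    fun he => E.κ_ne i (ofRealHom_comp_injective he)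
  simpa using this

theorem IsPVUnit.norm_σ_lt_one (h : IsPVUnit lam) (E : Conjugates lam m s) (j : Fin s) :
    ‖E.σ j (AdjoinSimple.gen ℚ lam)‖ < 1 :=
  h.norm_embedding_lt_one (E.σ j) fun he => E.σ_nonreal j (he ▸ isReal_ofRealHom_comp _)

/-! ### The dilation on internal space. -/

instance isAddHaarMeasure_volume_internal :
    (volume : Measure (Internal m s)).IsAddHaarMeasure :=
  Measure.prod.instIsAddHaarMeasure volume volume

/-- The dilation on internal space, as a linear map. -/
def QLin (E : Conjugates lam m s) : Internal m s →ₗ[ℝ] Internal m s :=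
  (LinearMap.pi fun i => (LinearMap.mulLeft ℝ (E.κ i (AdjoinSimple.gen ℚ lam))).comp
    (LinearMap.proj i)).prodMap
  (LinearMap.pi fun j => (LinearMap.mulLeft ℝ (E.σ j (AdjoinSimple.gen ℚ lam))).comp
    (LinearMap.proj j))

/-- The dilation on internal space, as a continuous linear map. -/
def QCLM (E : Conjugates lam m s) : Internal m s →L[ℝ] Internal m s :=
  (QLin E).toContinuousLinearMap

theorem coe_QCLM (E : Conjugates lam m s) : ⇑(QCLM E) = Q E := rfl

theorem continuous_Q (E : Conjugates lam m s) : Continuous (Q E) := (QCLM E).continuous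

theorem det_mulLeft_complex (z : ℂ) : LinearMap.det (LinearMap.mulLeft ℝ z) = ‖z‖ ^ 2 := by
  have := Algebra.norm_complex_apply z
  rw [Complex.normSq_eq_norm_sq] at this
  exact this

theorem IsPVUnit.abs_det_QLin (h : IsPVUnit lam) (E : Conjugates lam m s) :
    |LinearMap.det (QLin E)| = lam⁻¹ := by
  rw [← h.prod_conjugates E, QLin, LinearMap.det_prodMap, LinearMap.det_pi, LinearMap.det_pi]
  simp only [det_mulLeft_complex, LinearMap.det_ring, LinearMap.mulLeft_apply, mul_one]
  rw [abs_mul, Finset.abs_prod, abs_of_nonneg (a := ∏ j, _ ^ 2) (by positivity)]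

theorem starMap_add (E : Conjugates lam m s) (x y : ℚ⟮lam⟯) :
    starMap E (x + y) = starMap E x + starMap E y := by
  ext <;> simp [starMap]

theorem starMap_sub (E : Conjugates lam m s) (x y : ℚ⟮lam⟯) :
    starMap E (x - y) = starMap E x - starMap E y := by
  ext <;> simp [starMap]

theorem starMap_zero (E : Conjugates lam m s) : starMap E 0 = 0 := by
  ext <;> simp [starMap]

theorem starMap_gen_mul (E : Conjugates lam m s) (x : ℚ⟮lam⟯) :
    starMap E (AdjoinSimple.gen ℚ lam * x) = Q E (starMap E x) := by
  ext <;> simp [starMap, Q]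

theorem Q_add (E : Conjugates lam m s) (x y : Internal m s) : Q E (x + y) = Q E x + Q E y :=
  (QLin E).map_add x y

theorem IsPVUnit.volume_image (h : IsPVUnit lam) (E : Conjugates lam m s) (c : Internal m s)
    (S : Set (Internal m s)) :
    volume ((fun y => Q E y + c) '' S) = ENNReal.ofReal lam⁻¹ * volume S := by
  have : (fun y => Q E y + c) '' S = (fun y => y + c) '' (QLin E '' S) := by
    rw [Set.image_image]; rfl
  rw [this, ← h.abs_det_QLin E, Set.image_add_right, measure_preimage_add_right,
    Measure.addHaar_image_linearMap]

theorem IsPVUnit.Q_injective (h : IsPVUnit lam) (E : Conjugates lam m s) :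
    Function.Injective (Q E) := by
  have h0 : LinearMap.det (QLin E) ≠ 0 := by
    intro h0
    have := h.abs_det_QLin E
    rw [h0, abs_zero] at this
    exact (inv_pos.2 (zero_lt_one.trans h.1)).ne this
  exact ((QLin E).equivOfDetNeZero h0).injective

theorem IsPVUnit.isClosedEmbedding (h : IsPVUnit lam) (E : Conjugates lam m s)
    (c : Internal m s) : Topology.IsClosedEmbedding fun y => Q E y + c := by
  have h1 : Topology.IsClosedEmbedding (Q E) :=
    LinearMap.isClosedEmbedding_of_injective (f := QLin E)
      (LinearMap.ker_eq_bot.2 (h.Q_injective E))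
  exact (Homeomorph.addRight c).isClosedEmbedding.comp h1

theorem IsPVUnit.measurableEmbedding (h : IsPVUnit lam) (E : Conjugates lam m s)
    (c : Internal m s) : MeasurableEmbedding fun y => Q E y + c :=
  (h.isClosedEmbedding E c).measurableEmbedding

/-- Volumes shrink by λ⁻¹, so the density grows by λ; this cancels the prefactor in `measureStep`.
-/
theorem IsPVUnit.map_restrict_volume (h : IsPVUnit lam) (E : Conjugates lam m s)
    (c : Internal m s) (S : Set (Internal m s)) :
    (volume.restrict S).map (fun y => Q E y + c) =
      ENNReal.ofReal lam • volume.restrict ((fun y => Q E y + c) '' S) := by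
  have hpos : 0 < lam := zero_lt_one.trans h.1
  have hme := h.measurableEmbedding E c
  ext B hB
  rw [hme.map_apply, Measure.restrict_apply (hme.measurable hB), Measure.smul_apply,
    Measure.restrict_apply hB, smul_eq_mul, ← Set.image_preimage_inter, h.volume_image,
    ← mul_assoc, ← ENNReal.ofReal_mul hpos.le, mul_inv_cancel₀ hpos.ne', ENNReal.ofReal_one,
    one_mul]

theorem dirac_conv_map_Q (E : Conjugates lam m s) (c : Internal m s)
    (μ : Measure (Internal m s)) [SFinite μ] :
    (Measure.dirac c).conv (μ.map (Q E)) = μ.map fun y => Q E y + c := by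
  rw [Measure.dirac_conv, Measure.map_map (by fun_prop) (continuous_Q E).measurable]
  congr 1
  ext1 y
  exact add_comm _ _

theorem IsPVUnit.tendsto_Q_iterate (h : IsPVUnit lam) (E : Conjugates lam m s)
    (y : Internal m s) : Filter.Tendsto (fun n => (Q E)^[n] y) Filter.atTop (nhds 0) := by
  have hn : ∀ n, (Q E)^[n] y = (fun i => (E.κ i (AdjoinSimple.gen ℚ lam)) ^ n * y.1 i,
      fun j => (E.σ j (AdjoinSimple.gen ℚ lam)) ^ n * y.2 j) := by
    intro n
    induction n with
    | zero => simp
    | succ n ih =>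
      rw [Function.iterate_succ_apply', ih]
      simp [Q, pow_succ', mul_assoc]
  simp_rw [hn]
  refine Filter.Tendsto.prodMk_nhds (tendsto_pi_nhds.2 fun i => ?_) (tendsto_pi_nhds.2 fun j => ?_)
  · simpa using (tendsto_pow_atTop_nhds_zero_of_abs_lt_one (h.abs_κ_lt_one E i)).mul_const (y.1 i)
  · simpa using (tendsto_pow_atTop_nhds_zero_of_norm_lt_one (h.norm_σ_lt_one E j)).mul_const (y.2 j)

/-! ### Combinatorics of displacements and supertiles. -/

variable {A : Type*}

theorem card_filter_getElem?_eq_some [DecidableEq A] (L : List A) (i : A) :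
    ((Finset.range L.length).filter fun k => L[k]? = some i).card = L.count i := by
  rw [← Nat.count_eq_card_filter_range]
  induction L with
  | nil => simp
  | cons a L ih =>
    rw [List.length_cons, Nat.count_succ', List.count_cons]
    simp [ih]

theorem injOn_sum_map_take {len : A → ℝ} (hpos : ∀ i, 0 < len i) (L : List A) :
    Set.InjOn (fun k => ((L.take k).map len).sum) (Set.Iic L.length) := by
  refine StrictMonoOn.injOn fun k _ l hl hkl => ?_
  obtain ⟨r, rfl⟩ := Nat.exists_eq_add_of_lt hkl
  simp only [Set.mem_Iic] at hl
  rw [add_assoc, List.take_add, List.map_append, List.sum_append, lt_add_iff_pos_right]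
  refine List.sum_pos _ ?_ ?_
  · simp only [List.mem_map]
    rintro _ ⟨a, -, rfl⟩
    exact hpos a
  · rw [Ne, ← List.length_eq_zero_iff]
    simp
    omega

theorem exists_getElem?_sum_map_take_le {len : A → ℝ} (L : List A) :
    ∀ y : ℝ, 0 ≤ y → y < (L.map len).sum → ∃ k i, k < L.length ∧ L[k]? = some i ∧
      ((L.take k).map len).sum ≤ y ∧ y < ((L.take k).map len).sum + len i := by
  induction L with
  | nil => intro y h0 h1; simp at h1; linarith
  | cons a L ih =>
    intro y h0 h1
    by_cases hy : y < len a
    · exact ⟨0, a, by simp, by simp, by simpa using h0, by simpa using hy⟩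
    · simp only [List.map_cons, List.sum_cons] at h1
      obtain ⟨k, i, hk, hi, h2, h3⟩ := ih (y - len a) (by linarith) (by linarith)
      exact ⟨k + 1, i, by simpa using hk, by simpa using hi, by
          rw [List.take_succ_cons, List.map_cons, List.sum_cons]; linarith, by
          rw [List.take_succ_cons, List.map_cons, List.sum_cons]; linarith⟩

theorem coe_sum_map (len : A → ℚ⟮lam⟯) (L : List A) :
    (((L.map len).sum : ℚ⟮lam⟯) : ℝ) = (L.map fun i => (len i : ℝ)).sum := by
  induction L with
  | nil => simp
  | cons a L ih => simp [ih]

/-- Positive tile lengths make the positions pairwise distinct, so passing to a set of positions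
loses no multiplicity. -/
theorem card_displacement [DecidableEq A] [DecidableEq ℚ⟮lam⟯] (ρ : A → List A)
    {len : A → ℚ⟮lam⟯} (hpos : ∀ i, 0 < (len i : ℝ)) (i j : A) :
    (displacement ρ len i j).card = (ρ j).count i := by
  rw [displacement, Finset.card_image_of_injOn, card_filter_getElem?_eq_some]
  intro k hk l hl hkl
  simp only [Finset.coe_filter, Finset.mem_range, Set.mem_ofPred_eq] at hk hl
  refine injOn_sum_map_take hpos (ρ j) (Set.mem_Iic.2 hk.1.le) (Set.mem_Iic.2 hl.1.le) ?_
  simp only at hkl ⊢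
  rw [← coe_sum_map, ← coe_sum_map, hkl]

theorem sum_map_len [Fintype A] [DecidableEq A] {ρ : A → List A} {len : A → ℝ}
    (hlen : len ᵥ* substMatrix ρ = lam • len) (j : A) :
    ((ρ j).map len).sum = lam * len j := by
  have h := congrFun hlen j
  simp only [Matrix.vecMul, dotProduct, substMatrix, Matrix.of_apply, Pi.smul_apply,
    smul_eq_mul] at h
  rw [← h, Finset.sum_list_map_count, Finset.sum_subset (Finset.subset_univ _)]
  · simp [mul_comm]
  · intro x _ hx
    rw [List.mem_toFinset] at hx
    simp [List.count_eq_zero_of_not_mem hx]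

theorem IsWindow.mem {E : Conjugates lam m s} {T : A → A → Finset ℚ⟮lam⟯}
    {W : A → TopologicalSpace.NonemptyCompacts (Internal m s)} (hW : IsWindow E T W)
    {i j : A} {t : ℚ⟮lam⟯} (ht : t ∈ T i j) {y : Internal m s} (hy : y ∈ W j) :
    Q E y + starMap E t ∈ W i := by
  rw [← SetLike.mem_coe, hW i]
  simp only [Set.mem_iUnion]
  exact ⟨j, t, ht, y, hy, rfl⟩

/-- The level-`n` supertile of type `j` is covered by tiles. The left endpoint `x` of each of them
is an algebraic integer, and its star image maps a copy of the window of `j` into a window. -/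
theorem IsWindow.exists_tile [Fintype A] [DecidableEq A] [DecidableEq ℚ⟮lam⟯] {ρ : A → List A}
    (hPV : IsPVUnit lam) {len : A → ℚ⟮lam⟯}
    (hlen : (fun i => (len i : ℝ)) ᵥ* substMatrix ρ = lam • fun i => (len i : ℝ))
    (hint : ∀ i, IsIntegral ℤ (len i))
    {E : Conjugates lam m s} {W : A → TopologicalSpace.NonemptyCompacts (Internal m s)}
    (hW : IsWindow E (displacement ρ len) W) (j : A) (n : ℕ) :
    ∀ y : ℝ, 0 ≤ y → y < lam ^ n * len j → ∃ i, ∃ x : ℚ⟮lam⟯, IsIntegral ℤ x ∧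
      (x : ℝ) ≤ y ∧ y < x + len i ∧ ∀ w ∈ W j, (Q E)^[n] w + starMap E x ∈ W i := by
  have hl0 : 0 < lam := zero_lt_one.trans hPV.1
  induction n with
  | zero =>
    intro y h0 h1
    exact ⟨j, 0, isIntegral_zero, by simpa using h0, by simpa using h1, fun w hw => by
      simpa [starMap_zero] using hw⟩
  | succ n ih =>
    intro y h0 h1
    -- Deflate: the tile [x, x + len k) covering y / λ inflates to a supertile of type k at λx,
    -- which contains y.
    obtain ⟨k, x, hx, hxy, hyx, hmem⟩ := ih (y / lam) (by positivity) (by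
      rw [div_lt_iff₀ hl0]; rw [pow_succ] at h1; linarith)
    rw [le_div_iff₀ hl0] at hxy
    rw [div_lt_iff₀ hl0] at hyx
    obtain ⟨p, i, hp, hpi, h2, h3⟩ := exists_getElem?_sum_map_take_le
      (len := fun i => (len i : ℝ)) (ρ k) (y - x * lam) (by linarith)
      (by rw [sum_map_len hlen]; linarith)
    rw [← coe_sum_map] at h2 h3
    set t := (((ρ k).take p).map len).sum with ht
    have hgen : ((AdjoinSimple.gen ℚ lam : ℚ⟮lam⟯) : ℝ) = lam := AdjoinSimple.coe_gen ℚ lam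
    refine ⟨i, AdjoinSimple.gen ℚ lam * x + t, ?_, ?_, ?_, fun w hw => ?_⟩
    · refine ((isIntegral_of_coe (by rw [hgen]; exact hPV.2.1)).mul hx).add ?_
      rw [ht]
      refine (integralClosure ℤ ℚ⟮lam⟯).list_sum_mem fun z hz => ?_
      obtain ⟨a, -, rfl⟩ := List.mem_map.1 hz
      exact hint a
    · push_cast; rw [hgen]; linarith
    · push_cast; rw [hgen]; linarith
    · rw [starMap_add, starMap_gen_mul, Function.iterate_succ_apply', ← add_assoc, ← Q_add]
      refine hW.mem ?_ (hmem w hw)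
      simp only [displacement, Finset.mem_image, Finset.mem_filter, Finset.mem_range]
      exact ⟨p, ⟨hp, hpi⟩, rfl⟩

/-! ### Positive volume of the windows. -/

/-- A compact set that contains `N` points with distances of order at least `N ^ (-1 / D)`, for
every `N`, has positive Lebesgue measure in dimension `D`. -/
theorem measure_pos_of_separated {F : Type*} [NormedAddCommGroup F] [NormedSpace ℝ F]
    [FiniteDimensional ℝ F] [MeasurableSpace F] [BorelSpace F] (μ : Measure F)
    [μ.IsAddHaarMeasure] (hD : 0 < Module.finrank ℝ F) {K : Set F} (hK : IsCompact K) {C : ℝ}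
    (hC : 0 < C)
    (h : ∀ N : ℕ, 0 < N → ∃ p : Fin N → F, (∀ q, p q ∈ K) ∧
      ∀ q q', q < q' → 1 ≤ C * N * dist (p q) (p q') ^ Module.finrank ℝ F) :
    0 < μ K := by
  set D := Module.finrank ℝ F with hDdef
  -- Half the guaranteed separation: balls of radius r N are disjoint, and N * r N ^ D = 1 / (2 ^ D
  -- * C) does not depend on N.
  let r : ℕ → ℝ := fun N => (1 / (C * N)) ^ (1 / (D : ℝ)) / 2
  have hr0 : ∀ N : ℕ, 0 < N → 0 < r N := fun N hN => by
    have : (0 : ℝ) < N := by exact_mod_cast hN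
    positivity
  have hrD : ∀ N : ℕ, 0 < N → (2 * r N) ^ D * (C * N) = 1 := fun N hN => by
    have hN' : (0 : ℝ) < N := by exact_mod_cast hN
    have : 2 * r N = (1 / (C * N)) ^ (1 / (D : ℝ)) := by simp only [r]; ring
    rw [this, one_div (D : ℝ), Real.rpow_inv_natCast_pow (by positivity) hD.ne']
    field_simp
  have hlim : Filter.Tendsto r Filter.atTop (nhds 0) := by
    have h1 : Filter.Tendsto (fun N : ℕ => 1 / (C * N)) Filter.atTop (nhds 0) := by
      simp_rw [one_div]
      exact (tendsto_natCast_atTop_atTop.const_mul_atTop hC).inv_tendsto_atTop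
    have h2 := (h1.rpow_const (p := 1 / (D : ℝ)) (Or.inr (by positivity))).div_const 2
    rwa [Real.zero_rpow (by positivity), zero_div] at h2
  have hle : ∀ N : ℕ, 0 < N →
      ENNReal.ofReal (1 / (2 ^ D * C)) * μ (Metric.ball 0 1) ≤ μ (Metric.cthickening (r N) K) := by
    intro N hN
    have hN' : (0 : ℝ) < N := by exact_mod_cast hN
    obtain ⟨p, hpK, hp⟩ := h N hN
    have hdist : ∀ q q', q ≠ q' → 2 * r N ≤ dist (p q) (p q') := by
      have key : ∀ q q', q < q' → 2 * r N ≤ dist (p q) (p q') := fun q q' hq => by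
        have h1 := hp q q' hq
        rw [← hrD N hN, mul_comm _ (C * (N : ℝ))] at h1
        exact le_of_pow_le_pow_left₀ hD.ne' dist_nonneg (le_of_mul_le_mul_left h1 (by positivity))
      intro q q' hq
      rcases lt_or_gt_of_ne hq with hq | hq
      · exact key q q' hq
      · rw [dist_comm]; exact key q' q hq
    have hdisj : Pairwise (Function.onFun Disjoint fun q => Metric.ball (p q) (r N)) :=
      fun q q' hq => Metric.ball_disjoint_ball (by linarith [hdist q q' hq])
    calc ENNReal.ofReal (1 / (2 ^ D * C)) * μ (Metric.ball 0 1)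
        = N * (ENNReal.ofReal (r N ^ D) * μ (Metric.ball 0 1)) := by
          rw [← mul_assoc, ← ENNReal.ofReal_natCast, ← ENNReal.ofReal_mul hN'.le]
          congr 2
          have h1 := hrD N hN
          rw [mul_pow] at h1
          field_simp
          linarith
      _ = ∑ q, μ (Metric.ball (p q) (r N)) := by
          simp [Measure.addHaar_ball_of_pos μ _ (hr0 N hN), ← hDdef]
      _ = μ (⋃ q, Metric.ball (p q) (r N)) := by
          rw [measure_iUnion hdisj fun q => measurableSet_ball, tsum_fintype]
      _ ≤ μ (Metric.cthickening (r N) K) := by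
          refine measure_mono (Set.iUnion_subset fun q y hy => ?_)
          exact Metric.mem_cthickening_of_dist_le y (p q) _ K (hpK q) (Metric.mem_ball.1 hy).le
  -- The closed thickenings of a compact set decrease to it in measure, so the uniform lower bound
  -- survives.
  have hge := ge_of_tendsto ((tendsto_measure_cthickening_of_isCompact (μ := μ) hK).comp hlim)
    (Filter.eventually_atTop.2 ⟨1, fun N hN => hle N hN⟩)
  refine lt_of_lt_of_le ?_ hge
  exact ENNReal.mul_pos (by simpa using by positivity) (Metric.measure_ball_pos μ 0 one_pos).ne'

theorem finrank_internal : Module.finrank ℝ (Internal m s) = m + 2 * s := by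
  simp [Module.finrank_prod, Module.finrank_pi_fintype, Complex.finrank_real_complex, mul_comm]

theorem IsWindow.volume_iUnion_pos [Fintype A] [Nonempty A] [DecidableEq A]
    [DecidableEq ℚ⟮lam⟯] {ρ : A → List A} (hPV : IsPVUnit lam) {len : A → ℚ⟮lam⟯}
    (hlen : (fun i => (len i : ℝ)) ᵥ* substMatrix ρ = lam • fun i => (len i : ℝ))
    (hpos : ∀ i, 0 < (len i : ℝ)) (hint : ∀ i, IsIntegral ℤ (len i))
    {E : Conjugates lam m s} {W : A → TopologicalSpace.NonemptyCompacts (Internal m s)}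
    (hW : IsWindow E (displacement ρ len) W) :
    0 < volume (⋃ i, (W i : Set (Internal m s))) := by
  obtain ⟨j⟩ := ‹Nonempty A›
  obtain ⟨w, hw⟩ := (W j).nonempty
  -- No tile is longer than b, so the half-open tiles covering 0, b, 2b, … are pairwise distinct.
  set b : ℝ := ∑ i, (len i : ℝ) with hb
  have hlb : ∀ i, (len i : ℝ) ≤ b := fun i =>
    Finset.single_le_sum (f := fun i => (len i : ℝ)) (fun i _ => (hpos i).le) (Finset.mem_univ i)
  have hb0 : 0 < b := (hpos j).trans_le (hlb j)
  refine measure_pos_of_separated volume (by rw [finrank_internal]; exact hPV.dim_pos E)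
    (isCompact_iUnion fun i => (W i).isCompact) hb0 fun N hN => ?_
  obtain ⟨n, hn⟩ : ∃ n : ℕ, N * b < lam ^ n * len j := by
    obtain ⟨n, hn⟩ := pow_unbounded_of_one_lt (N * b / len j) hPV.1
    exact ⟨n, by rwa [div_lt_iff₀ (hpos j)] at hn⟩
  have hex : ∀ q : Fin N, ∃ i, ∃ x : ℚ⟮lam⟯, IsIntegral ℤ x ∧ (x : ℝ) ≤ q * b ∧
      q * b < x + len i ∧ ∀ w ∈ W j, (Q E)^[n] w + starMap E x ∈ W i := fun q =>
    hW.exists_tile hPV hlen hint j n _ (by positivity) (by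
      refine lt_of_le_of_lt ?_ hn
      have : (q : ℝ) ≤ N := by exact_mod_cast q.2.le
      gcongr)
  choose i x hx hxq hqx hmem using hex
  refine ⟨fun q => (Q E)^[n] w + starMap E (x q),
    fun q => Set.mem_iUnion.2 ⟨i q, hmem q w hw⟩, fun q q' hq => ?_⟩
  have hqq : (q : ℝ) + 1 ≤ q' := by exact_mod_cast hq
  have hqN : (q' : ℝ) + 1 ≤ N := by exact_mod_cast q'.2
  have hq0 : (0 : ℝ) ≤ q := by positivity
  have h1 : (x q : ℝ) < x q' := by nlinarith [hqx q', hxq q, hlb (i q')]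
  -- The difference is at most (q' - q + 1) * b, and q' + 1 ≤ N.
  have h2 : |((x q' - x q : ℚ⟮lam⟯) : ℝ)| ≤ b * N := by
    push_cast
    rw [abs_of_pos (by linarith)]
    nlinarith [hqx q, hxq q', hlb (i q)]
  have h3 : dist ((Q E)^[n] w + starMap E (x q)) ((Q E)^[n] w + starMap E (x q')) =
      ‖starMap E (x q' - x q)‖ := by
    rw [dist_add_left, dist_comm, dist_eq_norm, starMap_sub]
  rw [h3, finrank_internal]
  refine (E.one_le_mul_norm_starMap_pow hPV.isIntegral_rat ((hx q').sub (hx q)) ?_).trans ?_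
  · intro h0
    rw [sub_eq_zero] at h0
    rw [h0] at h1
    exact h1.false
  · gcongr

/-! ### Uniqueness of the Perron–Frobenius eigenvector. -/

theorem substMatrix_mulVec_apply [Fintype A] [DecidableEq A] (ρ : A → List A) (u : A → ℝ) (i : A) :
    (substMatrix ρ *ᵥ u) i = ∑ j, ((ρ j).count i : ℝ) * u j := rfl

/-- Non-negative eigenvectors of a primitive matrix are multiples of the positive one. -/
theorem eq_smul_of_isPrimitive [Fintype A] [Nonempty A] [DecidableEq A] {M : Matrix A A ℝ}
    (hM : M.IsPrimitive) {v w : A → ℝ} (hv : M *ᵥ v = lam • v) (hv_pos : ∀ i, 0 < v i)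
    (hw : M *ᵥ w = lam • w) (hw_nonneg : ∀ i, 0 ≤ w i) (hw_ne : w ≠ 0) :
    ∃ c : ℝ, 0 < c ∧ w = c • v := by
  -- Subtract the largest multiple of v that keeps w - c • v non-negative. It vanishes at i₀, and
  -- row i₀ of a strictly positive power of M then forces it to vanish everywhere.
  obtain ⟨i₀, hi₀⟩ := Finite.exists_min fun i => w i / v i
  set c := w i₀ / v i₀ with hc
  have hu : ∀ i, 0 ≤ (w - c • v) i := fun i => by
    have := (le_div_iff₀ (hv_pos i)).1 (hi₀ i)
    simpa using this
  have hu0 : (w - c • v) i₀ = 0 := by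
    simp [hc, div_mul_cancel₀ _ (hv_pos i₀).ne']
  have hMu : ∀ n : ℕ, M ^ n *ᵥ (w - c • v) = lam ^ n • (w - c • v) := by
    intro n
    induction n with
    | zero => simp
    | succ n ih =>
      rw [pow_succ, ← Matrix.mulVec_mulVec, Matrix.mulVec_sub, Matrix.mulVec_smul, hv, hw,
        smul_comm c lam, ← smul_sub, Matrix.mulVec_smul, ih, smul_smul, pow_succ']
  obtain ⟨k, -, hk⟩ := hM.exists_pos_pow
  have h0 : ∑ j, (M ^ k) i₀ j * (w - c • v) j = 0 := by
    have := congrFun (hMu k) i₀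
    rw [Pi.smul_apply, hu0, smul_zero] at this
    exact this
  rw [Finset.sum_eq_zero_iff_of_nonneg fun j _ => mul_nonneg (hk i₀ j).le (hu j)] at h0
  have hwc : w = c • v := by
    ext j
    have := (mul_eq_zero.1 (h0 j (Finset.mem_univ j))).resolve_left (hk i₀ j).ne'
    exact sub_eq_zero.1 this
  refine ⟨c, lt_of_le_of_ne (div_nonneg (hw_nonneg _) (hv_pos _).le) fun h => hw_ne ?_, hwc⟩
  rw [hwc, ← h, zero_smul]

/-! ### The measure iteration and its total masses. -/

theorem measureStep_apply [Fintype A] (E : Conjugates lam m s) (T : A → A → Finset ℚ⟮lam⟯)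
    (μ : A → Measure (Internal m s)) [∀ j, SFinite (μ j)] (i : A) :
    measureStep E T μ i = ENNReal.ofReal lam⁻¹ •
      ∑ j, ∑ t ∈ T i j, (μ j).map fun y => Q E y + starMap E t := by
  simp only [measureStep, dirac_conv_map_Q]

instance isFiniteMeasure_restrict_nonemptyCompacts
    (W : TopologicalSpace.NonemptyCompacts (Internal m s)) :
    IsFiniteMeasure (volume.restrict (W : Set (Internal m s))) :=
  isFiniteMeasure_restrict.2 W.isCompact.measure_lt_top.ne

theorem measurable_Q_add (E : Conjugates lam m s) (c : Internal m s) :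
    Measurable fun y => Q E y + c :=
  (continuous_Q E).measurable.add_const c

theorem measureStep_univ [Fintype A] (E : Conjugates lam m s) (T : A → A → Finset ℚ⟮lam⟯)
    (μ : A → Measure (Internal m s)) [∀ j, SFinite (μ j)] (i : A) :
    measureStep E T μ i Set.univ =
      ENNReal.ofReal lam⁻¹ * ∑ j, ((T i j).card : ENNReal) * μ j Set.univ := by
  rw [measureStep_apply]
  simp [Measure.map_apply (measurable_Q_add E _) MeasurableSet.univ]

theorem measureStep_smul [Fintype A] (E : Conjugates lam m s) (T : A → A → Finset ℚ⟮lam⟯)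
    (μ : A → Measure (Internal m s)) [∀ j, SFinite (μ j)] (c : ENNReal) :
    measureStep E T (fun i => c • μ i) = fun i => c • measureStep E T μ i := by
  ext1 i
  rw [measureStep_apply, measureStep_apply, smul_comm c]
  simp [Finset.smul_sum]

theorem mapsTo_massSpace [Fintype A] [DecidableEq A] [DecidableEq ℚ⟮lam⟯] {ρ : A → List A}
    (hlam : 0 < lam) {v : A → ℝ} (hv : substMatrix ρ *ᵥ v = lam • v) (hv_pos : ∀ i, 0 < v i)
    {len : A → ℚ⟮lam⟯} (hpos : ∀ i, 0 < (len i : ℝ)) (E : Conjugates lam m s) {α : ℝ}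
    (hα : 0 < α) :
    Set.MapsTo (measureStep E (displacement ρ len)) (massSpace m s α v) (massSpace m s α v) := by
  intro ν hν i
  have := fun j => (hν j).1
  have h : measureStep E (displacement ρ len) ν i Set.univ = ENNReal.ofReal (α * v i) := by
    rw [measureStep_univ]
    have h1 : ∀ j, ((displacement ρ len i j).card : ENNReal) * ν j Set.univ =
        ENNReal.ofReal (((ρ j).count i : ℝ) * (α * v j)) := fun j => by
      rw [card_displacement ρ hpos, (hν j).2, ENNReal.ofReal_mul (p := ((ρ j).count i : ℝ))
        (by positivity), ENNReal.ofReal_natCast]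
    simp_rw [h1]
    rw [← ENNReal.ofReal_sum_of_nonneg fun j _ => by have := (hv_pos j).le; positivity,
      ← ENNReal.ofReal_mul (by positivity)]
    congr 1
    have h2 := congrFun hv i
    rw [substMatrix_mulVec_apply, Pi.smul_apply, smul_eq_mul] at h2
    simp_rw [mul_left_comm _ α]
    rw [← Finset.mul_sum, h2]
    field_simp
  exact ⟨⟨by rw [h]; exact ENNReal.ofReal_lt_top⟩, h⟩

/-! ### Uniqueness by characteristic functions. -/

theorem charFunDual_measureStep [Fintype A] (hlam : 0 < lam) (E : Conjugates lam m s)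
    (T : A → A → Finset ℚ⟮lam⟯) (μ : A → Measure (Internal m s)) [∀ j, IsFiniteMeasure (μ j)]
    (L : StrongDual ℝ (Internal m s)) (i : A) :
    charFunDual (measureStep E T μ i) L = lam⁻¹ * ∑ j, ∑ t ∈ T i j,
      charFunDual (μ j) (L.comp (QCLM E)) * Complex.exp (L (starMap E t) * Complex.I) := by
  have hterm : ∀ j t, charFunDual ((μ j).map fun y => Q E y + starMap E t) L =
      charFunDual (μ j) (L.comp (QCLM E)) * Complex.exp (L (starMap E t) * Complex.I) := by
    intro j t
    have : (μ j).map (fun y => Q E y + starMap E t) =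
        ((μ j).map (QCLM E)).map (· + starMap E t) := by
      rw [Measure.map_map (by fun_prop) (by fun_prop)]
      rfl
    rw [this, charFunDual_map_add_const, charFunDual_map]
  rw [measureStep_apply]
  simp_rw [← hterm]
  simp only [charFunDual]
  rw [integral_smul_measure, integral_finsetSum_measure, ENNReal.toReal_ofReal (by positivity),
    Complex.real_smul, Complex.ofReal_inv]
  · congr 1
    refine Finset.sum_congr rfl fun j _ => ?_
    rw [integral_finsetSum_measure]
    intro t _
    exact BoundedContinuousFunction.integrable _ _
  · intro j _
    exact BoundedContinuousFunction.integrable _ _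

/-- L ∘ Qⁿ tends to 0 pointwise and the integrand has modulus 1, so dominated convergence applies.
-/
theorem IsPVUnit.tendsto_charFunDual (h : IsPVUnit lam) (E : Conjugates lam m s)
    (μ : Measure (Internal m s)) [IsFiniteMeasure μ] (L : StrongDual ℝ (Internal m s)) :
    Filter.Tendsto (fun n => charFunDual μ (L.comp (QCLM E ^ n))) Filter.atTop
      (nhds (μ.real Set.univ)) := by
  have h0 : ((μ.real Set.univ : ℝ) : ℂ) = ∫ _, (1 : ℂ) ∂μ := by simp
  rw [h0]
  simp_rw [charFunDual_apply]
  refine tendsto_integral_of_dominated_convergence (fun _ => 1)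
    (fun n => by fun_prop) (integrable_const _) (fun n => ?_) ?_
  · filter_upwards with y
    rw [Complex.norm_exp_ofReal_mul_I]
  · filter_upwards with y
    have h1 : Filter.Tendsto (fun n => (L.comp (QCLM E ^ n)) y) Filter.atTop (nhds 0) := by
      have := (L.continuous.tendsto 0).comp (h.tendsto_Q_iterate E y)
      rw [map_zero] at this
      refine this.congr fun n => ?_
      simp [coe_QCLM]
    have h2 : Continuous fun x : ℝ => Complex.exp (x * Complex.I) := by fun_prop
    simpa [Function.comp_def] using (h2.tendsto 0).comp h1

theorem eq_of_eq_measureStep [Fintype A] [DecidableEq A] [DecidableEq ℚ⟮lam⟯] {ρ : A → List A}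
    (hPV : IsPVUnit lam) {v : A → ℝ} (hv : substMatrix ρ *ᵥ v = lam • v) (hv_pos : ∀ i, 0 < v i)
    {len : A → ℚ⟮lam⟯} (hpos : ∀ i, 0 < (len i : ℝ)) (E : Conjugates lam m s) {α : ℝ}
    {μ ν : A → Measure (Internal m s)} (hμ : μ ∈ massSpace m s α v) (hν : ν ∈ massSpace m s α v)
    (hμ' : μ = measureStep E (displacement ρ len) μ)
    (hν' : ν = measureStep E (displacement ρ len) ν) : μ = ν := by
  have hlam : 0 < lam := zero_lt_one.trans hPV.1
  have := fun j => (hμ j).1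
  have := fun j => (hν j).1
  let d : A → StrongDual ℝ (Internal m s) → ℝ := fun i L =>
    ‖charFunDual (μ i) L - charFunDual (ν i) L‖
  have hd : ∀ i L, d i L ≤ lam⁻¹ * ∑ j, ((ρ j).count i : ℝ) * d j (L.comp (QCLM E)) := by
    intro i L
    simp only [d]
    -- The fixed-point equations unfold every occurrence of μ and ν, including those on the right;
    -- the reversed rewrites fold those back.
    rw [hμ', hν', charFunDual_measureStep hlam, charFunDual_measureStep hlam, ← hμ', ← hν',
      ← mul_sub, norm_mul, ← Finset.sum_sub_distrib]
    rw [Complex.norm_real, Real.norm_of_nonneg (inv_nonneg.2 hlam.le)]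
    gcongr
    refine (norm_sum_le _ _).trans (Finset.sum_le_sum fun j _ => ?_)
    rw [← Finset.sum_sub_distrib, ← card_displacement ρ hpos, ← nsmul_eq_mul]
    refine (norm_sum_le _ _).trans (Finset.sum_le_card_nsmul _ _ _ fun t _ => ?_)
    rw [← sub_mul, norm_mul, Complex.norm_exp_ofReal_mul_I, mul_one]
  -- The constant c is unchanged at each step because λ⁻¹M fixes v.
  have hstep : ∀ c : ℝ, ∀ n : ℕ, ∀ L, (∀ j, d j (L.comp (QCLM E ^ n)) ≤ c * v j) →
      ∀ j, d j L ≤ c * v j := by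
    intro c n
    induction n with
    | zero => intro L h j; exact h j
    | succ n ih =>
      intro L h j
      have h1 := ih (L.comp (QCLM E)) fun k => by
        have := h k
        rw [pow_succ'] at this
        exact this
      calc d j L ≤ lam⁻¹ * ∑ k, ((ρ k).count j : ℝ) * d k (L.comp (QCLM E)) := hd j L
        _ ≤ lam⁻¹ * ∑ k, ((ρ k).count j : ℝ) * (c * v k) := by
          gcongr with k; exact h1 k
        _ = c * v j := by
          have h2 := congrFun hv j
          rw [substMatrix_mulVec_apply, Pi.smul_apply, smul_eq_mul] at h2
          simp_rw [mul_left_comm _ c]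
          rw [← Finset.mul_sum, h2]
          field_simp
  have hlim : ∀ j (L : StrongDual ℝ (Internal m s)), Filter.Tendsto (fun n => d j (L.comp (QCLM E ^ n))) Filter.atTop
      (nhds 0) := by
    intro j L
    have h1 := ((hPV.tendsto_charFunDual E (μ j) L).sub
      (hPV.tendsto_charFunDual E (ν j) L)).norm
    rwa [measureReal_def, measureReal_def, (hμ j).2, (hν j).2, sub_self, norm_zero] at h1
  have hzero : ∀ j L, d j L ≤ 0 := by
    intro j L
    refine le_of_forall_pos_le_add fun ε hε => ?_
    have hc : 0 < ε / v j := div_pos hε (hv_pos j)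
    have hev : ∀ᶠ n in Filter.atTop, ∀ k, d k (L.comp (QCLM E ^ n)) ≤ ε / v j * v k :=
      Filter.eventually_all.2 fun k =>
        ((hlim k L).eventually_lt_const (mul_pos hc (hv_pos k))).mono fun n hn => hn.le
    obtain ⟨n, hn⟩ := hev.exists
    have := hstep _ n L hn j
    rwa [div_mul_cancel₀ _ (hv_pos j).ne', ← zero_add ε] at this
  ext1 j
  refine Measure.ext_of_charFunDual ?_
  ext L
  exact sub_eq_zero.1 (norm_le_zero_iff.1 (hzero j L))

/-! ### Invariance of Lebesgue measure on the windows. -/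

/-- This is subadditivity of volume on the window equation. Equality would say that the pieces
overlap only in null sets, which is not yet known. -/
theorem IsWindow.restrict_le_measureStep [Fintype A] (hPV : IsPVUnit lam)
    {E : Conjugates lam m s} {T : A → A → Finset ℚ⟮lam⟯}
    {W : A → TopologicalSpace.NonemptyCompacts (Internal m s)} (hW : IsWindow E T W) (i : A) :
    volume.restrict (W i : Set (Internal m s)) ≤
      measureStep E T (fun j => volume.restrict (W j : Set (Internal m s))) i := by
  have hlam : 0 < lam := zero_lt_one.trans hPV.1
  rw [measureStep_apply]
  simp_rw [hPV.map_restrict_volume]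
  refine Measure.le_iff.2 fun B hB => ?_
  rw [Measure.restrict_apply hB, hW i]
  simp only [Measure.smul_apply, Measure.finsetSum_apply, Measure.restrict_apply hB, smul_eq_mul,
    ← Finset.mul_sum, Set.inter_iUnion]
  rw [← mul_assoc, ← ENNReal.ofReal_mul (by positivity), inv_mul_cancel₀ hlam.ne',
    ENNReal.ofReal_one, one_mul]
  exact (measure_iUnion_fintype_le _ _).trans
    (Finset.sum_le_sum fun j _ => measure_biUnion_finset_le _ _)

/-- The windows have positive volume, the vector of the volumes is a right Perron-Frobenius
eigenvector, and the restrictions of Lebesgue measure to the windows are invariant. -/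
theorem IsWindow.volume_eq_and_invariant [Fintype A] [Nonempty A] [DecidableEq A]
    [DecidableEq ℚ⟮lam⟯] {ρ : A → List A} (hprim : (substMatrix ρ).IsPrimitive)
    (hPV : IsPVUnit lam) {v : A → ℝ} (hv : substMatrix ρ *ᵥ v = lam • v) (hv_pos : ∀ i, 0 < v i)
    {len : A → ℚ⟮lam⟯}
    (hlen : (fun i => (len i : ℝ)) ᵥ* substMatrix ρ = lam • fun i => (len i : ℝ))
    (hpos : ∀ i, 0 < (len i : ℝ)) (hint : ∀ i, IsIntegral ℤ (len i))
    {E : Conjugates lam m s} {W : A → TopologicalSpace.NonemptyCompacts (Internal m s)}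
    (hW : IsWindow E (displacement ρ len) W) :
    (∃ c : ℝ, 0 < c ∧ ∀ i, volume (W i : Set (Internal m s)) = ENNReal.ofReal (c * v i)) ∧
      measureStep E (displacement ρ len) (fun j => volume.restrict (W j : Set (Internal m s))) =
        fun j => volume.restrict (W j : Set (Internal m s)) := by
  have hlam : 0 < lam := zero_lt_one.trans hPV.1
  have hfin : ∀ i, volume (W i : Set (Internal m s)) ≠ ⊤ := fun i =>
    (W i).isCompact.measure_lt_top.ne
  set w : A → ℝ := fun i => (volume (W i : Set (Internal m s))).toReal with hwdef
  have hw : ∀ i, volume (W i : Set (Internal m s)) = ENNReal.ofReal (w i) := fun i =>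
    (ENNReal.ofReal_toReal (hfin i)).symm
  have hw0 : ∀ i, 0 ≤ w i := fun i => ENNReal.toReal_nonneg
  have hmass : ∀ i, measureStep E (displacement ρ len)
      (fun j => volume.restrict (W j : Set (Internal m s))) i Set.univ =
        ENNReal.ofReal (lam⁻¹ * ∑ j, ((ρ j).count i : ℝ) * w j) := by
    intro i
    rw [measureStep_univ, ENNReal.ofReal_mul (by positivity),
      ENNReal.ofReal_sum_of_nonneg fun j _ => mul_nonneg (by positivity) (hw0 j)]
    congr 1
    refine Finset.sum_congr rfl fun j _ => ?_
    rw [card_displacement ρ hpos, Measure.restrict_apply_univ, hw,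
      ENNReal.ofReal_mul (by positivity), ENNReal.ofReal_natCast]
  have hle : ∀ i, w i ≤ lam⁻¹ * ∑ j, ((ρ j).count i : ℝ) * w j := by
    intro i
    have h1 := hW.restrict_le_measureStep hPV i Set.univ
    rw [hmass, Measure.restrict_apply_univ, hw] at h1
    exact (ENNReal.ofReal_le_ofReal_iff (mul_nonneg (by positivity)
      (Finset.sum_nonneg fun j _ => mul_nonneg (by positivity) (hw0 j)))).1 h1
  -- Since `len` is a left eigenvector, w and λ⁻¹Mw pair equally with it; positivity of `len` then
  -- turns the entrywise inequality `hle` into equality.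
  have hsum : ∑ i, (len i : ℝ) * w i =
      ∑ i, (len i : ℝ) * (lam⁻¹ * ∑ j, ((ρ j).count i : ℝ) * w j) := by
    have h1 : (fun i => (len i : ℝ)) ⬝ᵥ (substMatrix ρ *ᵥ w) =
        lam * ((fun i => (len i : ℝ)) ⬝ᵥ w) := by
      rw [Matrix.dotProduct_mulVec, hlen, smul_dotProduct, smul_eq_mul]
    simp only [dotProduct, substMatrix_mulVec_apply] at h1
    simp_rw [mul_left_comm _ lam⁻¹]
    rw [← Finset.mul_sum, h1]
    field_simp
  have heq : ∀ i, w i = lam⁻¹ * ∑ j, ((ρ j).count i : ℝ) * w j := fun i =>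
    mul_left_cancel₀ (hpos i).ne' ((Finset.sum_eq_sum_iff_of_le fun i _ =>
      mul_le_mul_of_nonneg_left (hle i) (hpos i).le).1 hsum i (Finset.mem_univ i))
  constructor
  · have hMw : substMatrix ρ *ᵥ w = lam • w := by
      ext i
      rw [substMatrix_mulVec_apply, Pi.smul_apply, smul_eq_mul, heq i, mul_inv_cancel_left₀ hlam.ne']
    have hne : w ≠ 0 := by
      intro h0
      refine (hW.volume_iUnion_pos hPV hlen hpos hint).ne' (measure_iUnion_null fun i => ?_)
      rw [hw, h0]
      simp
    obtain ⟨c, hc, hwc⟩ := eq_smul_of_isPrimitive hprim hv hv_pos hMw hw0 hne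
    exact ⟨c, hc, fun i => by rw [hw, hwc]; rfl⟩
  · ext1 i
    -- A domination between finite measures of equal total mass is an equality.
    refine (Measure.eq_of_le_of_measure_univ_eq (hW.restrict_le_measureStep hPV i) ?_).symm
    rw [hmass, ← heq, Measure.restrict_apply_univ, hw]

end PVInflation

end

theorem mainTheorem7 {A : Type*} [Fintype A] [DecidableEq A]
    -- a primitive substitution whose Perron-Frobenius eigenvalue is a PV unit
    (ρ : A → List A) (hprim : (PVInflation.substMatrix ρ).IsPrimitive)
    (lam : ℝ) (hPF : PVInflation.IsPFEigenvalue (PVInflation.substMatrix ρ) lam)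
    (hPV : PVInflation.IsPVUnit lam)
    -- the right PF eigenvector, with frequency normalisation
    (v : A → ℝ) (hv : PVInflation.substMatrix ρ *ᵥ v = lam • v) (hv_pos : ∀ i, 0 < v i)
    (hv_sum : ∑ i, v i = 1)
    -- the natural tile lengths: a positive left PF eigenvector with entries in `ℤ[lam]`
    (len : A → ℚ⟮lam⟯)
    (hlen : (fun i => (len i : ℝ)) ᵥ* PVInflation.substMatrix ρ = lam • fun i => (len i : ℝ))
    (hlen_pos : ∀ i, 0 < (len i : ℝ))
    (hlen_mem : ∀ i, (len i : ℝ) ∈ Algebra.adjoin ℤ {lam})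
    -- the cut and project scheme and the windows
    {m s : ℕ} (E : PVInflation.Conjugates lam m s)
    (W : A → TopologicalSpace.NonemptyCompacts (PVInflation.Internal m s))
    (hW : PVInflation.IsWindow E (PVInflation.displacement ρ len) W)
    (α : ℝ) (hα : 0 < α) :
    Set.MapsTo (PVInflation.measureStep E (PVInflation.displacement ρ len))
      (PVInflation.massSpace m s α v) (PVInflation.massSpace m s α v) ∧
    {ν ∈ PVInflation.massSpace m s α v |
        ν = PVInflation.measureStep E (PVInflation.displacement ρ len) ν} =
      {PVInflation.windowMeasure α v W} := by
  have hne : Nonempty A := by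
    by_contra h
    rw [not_nonempty_iff] at h
    simp at hv_sum
  have hlam : 0 < lam := zero_lt_one.trans hPV.1
  have hint : ∀ i, IsIntegral ℤ (len i) := fun i => by
    refine PVInflation.isIntegral_of_coe ?_
    have h1 : Algebra.adjoin ℤ {lam} ≤ integralClosure ℤ ℝ :=
      Algebra.adjoin_le (Set.singleton_subset_iff.2 hPV.2.1)
    exact h1 (hlen_mem i)
  refine ⟨PVInflation.mapsTo_massSpace hlam hv hv_pos hlen_pos E hα, ?_⟩
  obtain ⟨⟨c, hc, hvol⟩, hinv⟩ :=
    hW.volume_eq_and_invariant hprim hPV hv hv_pos hlen hlen_pos hint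
  -- As vol (W i) = c * v i, the density α / c is the same for every i, so invariance follows from
  -- homogeneity of the iteration.
  have hWm : PVInflation.windowMeasure α v W = fun i => ENNReal.ofReal (α / c) •
      volume.restrict (W i : Set (PVInflation.Internal m s)) := by
    ext1 i
    have := hv_pos i
    rw [PVInflation.windowMeasure, hvol, ← ENNReal.ofReal_div_of_pos (by positivity)]
    congr 2
    field_simp
  have hmem : PVInflation.windowMeasure α v W ∈ PVInflation.massSpace m s α v := by
    intro i
    have h1 : PVInflation.windowMeasure α v W i Set.univ = ENNReal.ofReal (α * v i) := by
      rw [hWm, Measure.smul_apply, Measure.restrict_apply_univ, hvol, smul_eq_mul,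
        ← ENNReal.ofReal_mul (by positivity)]
      congr 1
      field_simp
    exact ⟨⟨by rw [h1]; exact ENNReal.ofReal_lt_top⟩, h1⟩
  have hfix : PVInflation.windowMeasure α v W = PVInflation.measureStep E
      (PVInflation.displacement ρ len) (PVInflation.windowMeasure α v W) := by
    rw [hWm, PVInflation.measureStep_smul, hinv]
  ext ν
  simp only [Set.mem_sep_iff, Set.mem_singleton_iff]
  constructor
  · rintro ⟨h1, h2⟩
    exact PVInflation.eq_of_eq_measureStep hPV hv hv_pos hlen_pos E h1 hmem h2 hfix
  · rintro rfl
    exact ⟨hmem, hfix⟩
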